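/- **Theorem 1.** Let $f:[0,\infty)\to\mathbb R$ be a standard operator monotone function, i.e. $0\le A\le B$ implies $f(A)\le f(B)$ for Hermitian matrices $A,B$ of any size, $f(x)=x f(1/x)$ for $x>0$, and $f(1)=1$; and let $f$ be regular, i.e. $f(0)>0$. Let $c_f(x,y)=[y f(x/y)]^{-1}$ (with $c_f(x,0)=[x f(0)]^{-1}$ for $x>0$), and for a density matrix $\rho$ and a Hermitian matrix $H$ let $$I^f(\rho,H)=\frac{f(0)}{2}\operatorname{Tr}\big[(i[H,\rho])\,c_f(L_\rho,R_\rho)(i[H,\rho])\big],\qquad L_\rho X=\rho X,\quad R_\rho X=X\rho,$$ be the associated metric-adjusted skew information. Then $I^f$ is not superadditive: 1. It is not true that $I^f(\rho_{1\dots N},H_{1\dots N})\ge\sum_{k=1}^N I^f(\rho_k,H_k)$ for all $N$, all $N$-partite density matrices $\rho_{1\dots N}$ (on finite-dimensional systems) with reduced states $\rho_k$, and all additive Hamiltonians $H_{1\dots N}=\sum_k H_k\otimes\mathbb I_{\bar k}$. 2. It is not true that $I^f(\rho_{12},H_{12})\ge I^f(\rho_1,H_1)+I^f(\rho_2,H_2)$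 for all bipartite density matrices $\rho_{12}$ and all $H_{12}=H_1\otimes\mathbb I+\mathbb I\otimes H_2$. 3. Violating states are produced by Åberg's protocol. Consider $N$ qubits, each with Hamiltonian $H_k=|1\rangle\langle1|$, and an ancilla $A$ with orthonormal basis $(|j\rangle)_{j\in\mathbb Z}$ and shift $\Delta|j\rangle=|j+1\rangle$. For $M\ge2$ and $l\in\mathbb Z$ let $|\eta^M_l\rangle=\frac1{\sqrt M}\sum_{i=0}^{M-1}|i+l\rangle$, and let $U=\frac1{\sqrt2}\begin{pmatrix}1&1\\1&-1\end{pmatrix}$. Starting from $|0\rangle^{\otimes N}\otimes|\eta^M_l\rangle$, apply for $m=1,\dots,N$ in turn the unitary $V(U)=\sum_{j,k=0}^{1}|j\rangle\langle j|U|k\rangle\langle k|\otimes\Delta^{k-j}$ to the $m$-th qubit and $A$, and then trace out $A$. The result is a density matrix $\rho_{1\dots N}$ on the $N$ qubits, and for every $M\ge2$ and $l$ there is $N_0$ such that for all $N\ge N_0$ $$I^f\Big(\rho_{1\dots N},\sum_k H_k\otimes\mathbb I_{\bar k}\Big)<\sum_{k=1}^N I^f(\rho_k,H_k).$$ -/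

import Mathlib

open scoped Matrix Kronecker ComplexConjugate ComplexOrder

noncomputable section

namespace SkewInfo

/-- `f` is a standard operator monotone function on `[0, ∞)` (only the values of `f` there matter).
`cfc f A` is the matrix function `f(A)` of the Hermitian matrix `A`. -/
structure IsStandardOperatorMonotone (f : ℝ → ℝ) : Prop where
  /-- `0 ≤ A ≤ B` implies `f(A) ≤ f(B)`, for Hermitian matrices of every size. -/
  monotone : ∀ (n : ℕ) (A B : Matrix (Fin n) (Fin n) ℂ),
    A.PosSemidef → (B - A).PosSemidef → (cfc f B - cfc f A).PosSemidef
  /-- `f(x) = x f(1/x)`. -/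
  symmetric : ∀ x : ℝ, 0 < x → f x = x * f (1 / x)
  /-- `f(1) = 1`. -/
  map_one : f 1 = 1

/-- `f` is regular: `f(0) > 0`. -/
def IsRegular (f : ℝ → ℝ) : Prop := 0 < f 0

/-- The Morozova-Chentsov function `c_f(x, y) = [y f(x / y)]⁻¹`, extended to `y = 0 < x` by
`y f(x / y) = x f(y / x)`, that is, by `c_f(x, 0) = [x f(0)]⁻¹`.
(The value at `(0, 0)` never contributes to the skew information.) -/
def morozovaChentsov (f : ℝ → ℝ) (x y : ℝ) : ℝ :=
  if y = 0 then (x * f 0)⁻¹ else (y * f (x / y))⁻¹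

section Single

variable {n : Type*} [Fintype n] [DecidableEq n]

/-- Density matrices. -/
def IsState (ρ : Matrix n n ℂ) : Prop := ρ.PosSemidef ∧ ρ.trace = 1

/-- The superoperator `c(L_ρ, R_ρ)`, the function `c` of the commuting operators
`L_ρ X = ρ X` and `R_ρ X = X ρ`: for `ρ = ∑ i, λ_i |i⟩⟨i|` it sends `X` to
`∑ i j, c(λ_i, λ_j) |i⟩⟨i| X |j⟩⟨j|`. -/
def leftRightCalculus (c : ℝ → ℝ → ℝ) {ρ : Matrix n n ℂ} (hρ : ρ.IsHermitian)
    (X : Matrix n n ℂ) : Matrix n n ℂ :=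
  let P : n → Matrix n n ℂ := fun i =>
    Matrix.vecMulVec (hρ.eigenvectorBasis i) (star (hρ.eigenvectorBasis i : n → ℂ))
  ∑ i, ∑ j, (c (hρ.eigenvalues i) (hρ.eigenvalues j) : ℂ) • (P i * X * P j)

open Classical in
/-- The metric-adjusted skew information
`I^f(ρ, H) = (f(0) / 2) Tr[ (i[H, ρ]) c_f(L_ρ, R_ρ)(i[H, ρ]) ]`
(set to `0` when `ρ` is not Hermitian). -/
def skewInfo (f : ℝ → ℝ) (ρ H : Matrix n n ℂ) : ℝ :=
  if hρ : ρ.IsHermitian then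
    f 0 / 2 * (Matrix.trace ((Complex.I • (H * ρ - ρ * H)) *
      leftRightCalculus (morozovaChentsov f) hρ (Complex.I • (H * ρ - ρ * H)))).re
  else 0

end Single

section Bipartite

variable {m n : Type*} [Fintype m] [Fintype n] [DecidableEq m] [DecidableEq n]

/-- `Tr₂ ρ₁₂`. -/
def marginalFst (ρ : Matrix (m × n) (m × n) ℂ) : Matrix m m ℂ :=
  fun a b => ∑ c, ρ (a, c) (b, c)

/-- `Tr₁ ρ₁₂`. -/
def marginalSnd (ρ : Matrix (m × n) (m × n) ℂ) : Matrix n n ℂ :=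
  fun a b => ∑ c, ρ (c, a) (c, b)

end Bipartite

section Multipartite

variable {N : ℕ} {d : Fin N → ℕ}

/-- The reduced state `ρ_k` of an `N`-partite state: the partial trace over all parties but the
`k`-th. -/
def marginal (k : Fin N) (ρ : Matrix ((j : Fin N) → Fin (d j)) ((j : Fin N) → Fin (d j)) ℂ) :
    Matrix (Fin (d k)) (Fin (d k)) ℂ :=
  fun a b => ∑ x with x k = a, ρ x (Function.update x k b)

/-- `A ⊗ 𝕀` with `A` acting on the `k`-th party and `𝕀` on the other ones. -/
def localOp (k : Fin N) (A : Matrix (Fin (d k)) (Fin (d k)) ℂ) :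
    Matrix ((j : Fin N) → Fin (d j)) ((j : Fin N) → Fin (d j)) ℂ :=
  fun x y => if ∀ j, j ≠ k → x j = y j then A (x k) (y k) else 0

/-- The additive Hamiltonian `∑ k, H_k ⊗ 𝕀`. -/
def totalHamiltonian (H : (k : Fin N) → Matrix (Fin (d k)) (Fin (d k)) ℂ) :
    Matrix ((j : Fin N) → Fin (d j)) ((j : Fin N) → Fin (d j)) ℂ :=
  ∑ k, localOp k (H k)

end Multipartite

/-- Superadditivity of `I^f`: for every number `N` of parties,
`I^f(ρ_{1…N}, H_{1…N}) ≥ ∑ k, I^f(ρ_k, H_k)`. -/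
def IsSuperadditive (f : ℝ → ℝ) : Prop :=
  ∀ (N : ℕ) (d : Fin N → ℕ)
    (ρ : Matrix ((j : Fin N) → Fin (d j)) ((j : Fin N) → Fin (d j)) ℂ)
    (H : (k : Fin N) → Matrix (Fin (d k)) (Fin (d k)) ℂ),
    IsState ρ → (∀ k, (H k).IsHermitian) →
      ∑ k, skewInfo f (marginal k ρ) (H k) ≤ skewInfo f ρ (totalHamiltonian H)

/-- Bipartite superadditivity of `I^f`: `I^f(ρ₁₂, H₁₂) ≥ I^f(ρ₁, H₁) + I^f(ρ₂, H₂)`. -/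
def IsBipartiteSuperadditive (f : ℝ → ℝ) : Prop :=
  ∀ (d₁ d₂ : ℕ) (ρ : Matrix (Fin d₁ × Fin d₂) (Fin d₁ × Fin d₂) ℂ)
    (H₁ : Matrix (Fin d₁) (Fin d₁) ℂ) (H₂ : Matrix (Fin d₂) (Fin d₂) ℂ),
    IsState ρ → H₁.IsHermitian → H₂.IsHermitian →
      skewInfo f (marginalFst ρ) H₁ + skewInfo f (marginalSnd ρ) H₂ ≤
        skewInfo f ρ (H₁ ⊗ₖ (1 : Matrix (Fin d₂) (Fin d₂) ℂ) +
          (1 : Matrix (Fin d₁) (Fin d₁) ℂ) ⊗ₖ H₂)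

/-! ### Åberg's protocol on `N` qubits

A vector of `(ℂ²)^{⊗N} ⊗ ℓ²(ℤ)` is given by its amplitudes `Ψ x a = ⟨x, a | Ψ⟩`, where
`x : Fin N → Fin 2` is a bit string and `a : ℤ` an energy level of the ancilla. -/

/-- The qubit Hamiltonian `|1⟩⟨1|`. -/
def qubitHamiltonian : Matrix (Fin 2) (Fin 2) ℂ := !![0, 0; 0, 1]

/-- The unitary `U = (1/√2) (1 1; 1 -1)`. -/
def hadamardGate : Matrix (Fin 2) (Fin 2) ℂ := (1 / (Real.sqrt 2 : ℂ)) • !![1, 1; 1, -1]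

/-- The ancilla state `|η^M_l⟩ = (1/√M) ∑_{i < M} |i + l⟩`. -/
def ancillaState (M : ℕ) (l : ℤ) (a : ℤ) : ℂ :=
  if l ≤ a ∧ a < l + M then 1 / (Real.sqrt M : ℂ) else 0

/-- The initial vector `|0⟩^{⊗N} ⊗ |η⟩`. -/
def abergInitial (N : ℕ) (η : ℤ → ℂ) (x : Fin N → Fin 2) (a : ℤ) : ℂ :=
  if x = 0 then η a else 0

/-- Åberg's unitary `V(U) = ∑ j k, |j⟩⟨j| U |k⟩⟨k| ⊗ Δ^{k - j}` applied to the `m`-th qubit and the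
ancilla; `Δ` is the shift `Δ |a⟩ = |a + 1⟩`, so `(Δ^s η)(a) = η (a - s)`. -/
def abergStep {N : ℕ} (U : Matrix (Fin 2) (Fin 2) ℂ) (m : Fin N)
    (Ψ : (Fin N → Fin 2) → ℤ → ℂ) (x : Fin N → Fin 2) (a : ℤ) : ℂ :=
  ∑ k : Fin 2, U (x m) k * Ψ (Function.update x m k) (a - (((k : ℕ) : ℤ) - ((x m : ℕ) : ℤ)))

/-- The joint vector after the protocol has been applied to the qubits `0, 1, …, N - 1` in turn. -/
def abergFinal (N : ℕ) (U : Matrix (Fin 2) (Fin 2) ℂ) (η : ℤ → ℂ) : (Fin N → Fin 2) → ℤ → ℂ :=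
  (List.finRange N).foldl (fun Ψ m => abergStep U m Ψ) (abergInitial N η)

/-- The state of the `N` qubits after the protocol: the ancilla is traced out. -/
def abergState (N : ℕ) (U : Matrix (Fin 2) (Fin 2) ℂ) (η : ℤ → ℂ) :
    Matrix (Fin N → Fin 2) (Fin N → Fin 2) ℂ :=
  fun x y => ∑' a : ℤ, abergFinal N U η x a * conj (abergFinal N U η y a)

end SkewInfo

end

/-! Tracing the ancilla out of the protocol leaves `tracedState η stringLevel`, whose entries are
`2⁻ᴺ` times overlaps of translates of `η` (`abergState_eq`). An overlap depends only on the
difference of the shifts, so all one-qubit marginals are the same state, and its off-diagonal entry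
is nonzero when `M ≥ 2`. Hence `∑ k, I^f(ρ_k, H_k) = N c` with `c > 0` independent of `N`.

The global state is a mixture, over the ancilla level, of vectors supported in an energy window of
width `M`. `skewInfo_le` bounds `I^f(B Bᴴ, H)` by twice the squared Hilbert–Schmidt norm of `H B - B
D` for any real diagonal `D`; with the bottoms of the windows as `D` this gives `I^f ≤ 2 M²` for
every `N`. So superadditivity fails once `N c > 2 M²`. In the bipartite case, splitting off one
qubit at a time would again force `I^f ≥ N c`. -/

namespace SkewInfo

/-! ### Skew information in an arbitrary orthonormal eigenbasis. -/

section Spectral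

variable {n : Type*} [Fintype n] [DecidableEq n]

lemma vecMulVec_eigenvectorBasis {ρ : Matrix n n ℂ} (hρ : ρ.IsHermitian) (i : n) :
    Matrix.vecMulVec (hρ.eigenvectorBasis i) (star (hρ.eigenvectorBasis i : n → ℂ)) =
      (hρ.eigenvectorUnitary : Matrix n n ℂ) * Matrix.single i i 1 *
        (hρ.eigenvectorUnitary : Matrix n n ℂ)ᴴ := by
  ext a b
  simp [Matrix.vecMulVec_apply, Matrix.mul_apply, Matrix.single_apply, ite_and,
    Matrix.IsHermitian.eigenvectorUnitary_apply]

/-- The double operator calculus in the chosen eigenbasis is an entrywise product. -/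
lemma leftRightCalculus_eq_eigenvectorUnitary (c : ℝ → ℝ → ℝ) {ρ : Matrix n n ℂ}
    (hρ : ρ.IsHermitian) (X : Matrix n n ℂ) :
    leftRightCalculus c hρ X = (hρ.eigenvectorUnitary : Matrix n n ℂ) *
      Matrix.of (fun i j => (c (hρ.eigenvalues i) (hρ.eigenvalues j) : ℂ) *
        ((hρ.eigenvectorUnitary : Matrix n n ℂ)ᴴ * X *
          (hρ.eigenvectorUnitary : Matrix n n ℂ)) i j) *
      (hρ.eigenvectorUnitary : Matrix n n ℂ)ᴴ := by
  unfold leftRightCalculus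
  simp only [vecMulVec_eigenvectorBasis]
  set U : Matrix n n ℂ := (hρ.eigenvectorUnitary : Matrix n n ℂ)
  have h : Matrix.of (fun i j => (c (hρ.eigenvalues i) (hρ.eigenvalues j) : ℂ) *
      (Uᴴ * X * U) i j) = ∑ i, ∑ j, (c (hρ.eigenvalues i) (hρ.eigenvalues j) : ℂ) •
        (Matrix.single i i (1 : ℂ) * (Uᴴ * X * U) * Matrix.single j j (1 : ℂ)) := by
    ext a b
    simp [Matrix.sum_apply, Matrix.single_apply, ite_and]
  rw [h]
  simp only [Matrix.mul_sum, Matrix.sum_mul, Matrix.mul_smul, Matrix.smul_mul, Matrix.mul_assoc]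

lemma mul_eigenvectorUnitary {ρ : Matrix n n ℂ} (hρ : ρ.IsHermitian) :
    ρ * (hρ.eigenvectorUnitary : Matrix n n ℂ) = (hρ.eigenvectorUnitary : Matrix n n ℂ) *
      Matrix.diagonal (fun i => (hρ.eigenvalues i : ℂ)) := by
  have h := hρ.spectral_theorem
  rw [Unitary.conjStarAlgAut_apply] at h
  have h' := congrArg (· * (hρ.eigenvectorUnitary : Matrix n n ℂ)) h
  simp only [Matrix.mul_assoc, Unitary.coe_star_mul_self, Matrix.mul_one] at h'
  exact h'

/-- The double operator calculus may be computed in any orthonormal eigenbasis. -/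
lemma leftRightCalculus_eq (c : ℝ → ℝ → ℝ) {ρ : Matrix n n ℂ} (hρ : ρ.IsHermitian)
    (X : Matrix n n ℂ) {V : Matrix n n ℂ} (hV : Vᴴ * V = 1) {μ : n → ℝ}
    (hμ : ρ * V = V * Matrix.diagonal (fun i => (μ i : ℂ))) :
    leftRightCalculus c hρ X = V *
      Matrix.of (fun i j => (c (μ i) (μ j) : ℂ) * (Vᴴ * X * V) i j) * Vᴴ := by
  rw [leftRightCalculus_eq_eigenvectorUnitary]
  have hUd := mul_eigenvectorUnitary hρ
  have hU : (hρ.eigenvectorUnitary : Matrix n n ℂ)ᴴ * (hρ.eigenvectorUnitary : Matrix n n ℂ) = 1 :=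
    Unitary.coe_star_mul_self _
  set U : Matrix n n ℂ := (hρ.eigenvectorUnitary : Matrix n n ℂ)
  have hU' : U * Uᴴ = 1 := mul_eq_one_comm.mp hU
  have hV' : V * Vᴴ = 1 := mul_eq_one_comm.mp hV
  set Z := Vᴴ * U with hZ
  have hUZ : U = V * Z := by rw [hZ, ← Matrix.mul_assoc, hV', Matrix.one_mul]
  have hZd : Z * Matrix.diagonal (fun i => (hρ.eigenvalues i : ℂ)) =
      Matrix.diagonal (fun i => (μ i : ℂ)) * Z := by
    have h1 : ρ = V * Matrix.diagonal (fun i => (μ i : ℂ)) * Vᴴ := by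
      rw [← hμ, Matrix.mul_assoc, hV', Matrix.mul_one]
    rw [hZ, Matrix.mul_assoc, ← hUd]
    conv_lhs => rw [h1]
    simp only [← Matrix.mul_assoc]
    rw [hV, Matrix.one_mul]
  -- The change of basis `Z` links equal eigenvalues only, so the weights `c` pass through it.
  have hZ1 : ∀ i j, Z i j ≠ 0 → hρ.eigenvalues j = μ i := by
    intro i j hij
    have h := congrFun (congrFun hZd i) j
    rw [Matrix.mul_diagonal, Matrix.diagonal_mul, mul_comm] at h
    exact_mod_cast mul_right_cancel₀ hij h
  have hUV : ∀ Y : Matrix n n ℂ, U * Y * Uᴴ = V * (Z * Y * Zᴴ) * Vᴴ := by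
    intro Y
    rw [hUZ, Matrix.conjTranspose_mul]
    simp only [Matrix.mul_assoc]
  have hVU : Vᴴ * X * V = Z * (Uᴴ * X * U) * Zᴴ := by
    rw [hZ, Matrix.conjTranspose_mul, Matrix.conjTranspose_conjTranspose]
    calc Vᴴ * X * V = Vᴴ * (U * Uᴴ) * X * (U * Uᴴ) * V := by rw [hU']; simp
      _ = _ := by simp only [Matrix.mul_assoc]
  rw [hUV, hVU]
  congr 2
  ext a b
  simp only [Matrix.mul_apply (M := Z * _), Matrix.mul_apply (M := Z), Matrix.of_apply,
    Finset.mul_sum, Finset.sum_mul]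
  refine Finset.sum_congr rfl fun j _ => Finset.sum_congr rfl fun i _ => ?_
  by_cases hi : Z a i = 0
  · simp [hi]
  by_cases hj : Z b j = 0
  · simp [hj]
  rw [hZ1 a i hi, hZ1 b j hj]
  ring

/-- The metric-adjusted skew information in terms of matrix elements in an orthonormal eigenbasis. -/
lemma skewInfo_eq (f : ℝ → ℝ) {ρ H : Matrix n n ℂ} (hρ : ρ.IsHermitian) (hH : H.IsHermitian)
    {V : Matrix n n ℂ} (hV : Vᴴ * V = 1) {μ : n → ℝ}
    (hμ : ρ * V = V * Matrix.diagonal (fun i => (μ i : ℂ))) :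
    skewInfo f ρ H = f 0 / 2 * ∑ i, ∑ j, morozovaChentsov f (μ i) (μ j) *
      ‖(Vᴴ * (H * ρ - ρ * H) * V) i j‖ ^ 2 := by
  rw [skewInfo, dif_pos hρ, leftRightCalculus_eq _ hρ _ hV hμ]
  congr 1
  set T := H * ρ - ρ * H with hT
  have hTT : Tᴴ = -T := by
    rw [hT, Matrix.conjTranspose_sub, Matrix.conjTranspose_mul, Matrix.conjTranspose_mul, hρ.eq,
      hH.eq, neg_sub]
  set K := Vᴴ * T * V with hK
  have hKK : Kᴴ = -K := by
    simp [hK, Matrix.conjTranspose_mul, hTT, Matrix.mul_assoc]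
  -- The commutator is skew-Hermitian; this sign cancels `I * I = -1` and leaves squared moduli.
  have hKij : ∀ i j, K j i = -star (K i j) := fun i j => by
    rw [← Matrix.conjTranspose_apply, hKK, Matrix.neg_apply, neg_neg]
  have h1 : Vᴴ * (Complex.I • T) * V = Complex.I • K := by simp [hK]
  rw [h1, Matrix.trace_mul_comm, Matrix.mul_assoc, Matrix.mul_assoc, Matrix.trace_mul_comm,
    Matrix.mul_assoc, h1, Matrix.trace, Complex.re_sum]
  refine Finset.sum_congr rfl fun i _ => ?_
  rw [Matrix.diag_apply, Matrix.mul_apply, Complex.re_sum]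
  refine Finset.sum_congr rfl fun j _ => ?_
  rw [Matrix.of_apply, Matrix.smul_apply, Matrix.smul_apply, hKij i j, ← Complex.normSq_eq_norm_sq]
  have h2 : K i j * star (K i j) = (Complex.normSq (K i j) : ℂ) := Complex.mul_conj _
  have : (morozovaChentsov f (μ i) (μ j) : ℂ) * Complex.I • K i j * Complex.I • -star (K i j) =
      ((morozovaChentsov f (μ i) (μ j) * Complex.normSq (K i j) : ℝ) : ℂ) := by
    rw [Complex.ofReal_mul, ← h2]
    simp only [smul_eq_mul]
    linear_combination (-(morozovaChentsov f (μ i) (μ j) : ℂ) * K i j * star (K i j)) *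
      Complex.I_mul_I
  rw [this, Complex.ofReal_re]

/-- The skew information does not depend on the labels of the basis. -/
lemma skewInfo_submatrix {m : Type*} [Fintype m] [DecidableEq m] (e : m ≃ n) (f : ℝ → ℝ)
    {ρ H : Matrix n n ℂ} (hρ : ρ.IsHermitian) (hH : H.IsHermitian) :
    skewInfo f (ρ.submatrix e e) (H.submatrix e e) = skewInfo f ρ H := by
  have hU : (hρ.eigenvectorUnitary : Matrix n n ℂ)ᴴ * (hρ.eigenvectorUnitary : Matrix n n ℂ) = 1 :=
    Unitary.coe_star_mul_self _
  have hμ := mul_eigenvectorUnitary hρ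
  rw [skewInfo_eq f hρ hH hU hμ]
  have hV : ((hρ.eigenvectorUnitary : Matrix n n ℂ).submatrix e e)ᴴ *
      (hρ.eigenvectorUnitary : Matrix n n ℂ).submatrix e e = 1 := by
    rw [Matrix.conjTranspose_submatrix, Matrix.submatrix_mul_equiv, hU, Matrix.submatrix_one_equiv]
  have hμ' : ρ.submatrix e e * (hρ.eigenvectorUnitary : Matrix n n ℂ).submatrix e e =
      (hρ.eigenvectorUnitary : Matrix n n ℂ).submatrix e e *
        Matrix.diagonal (fun i => ((hρ.eigenvalues ∘ e) i : ℂ)) := by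
    have : Matrix.diagonal (fun i => ((hρ.eigenvalues ∘ e) i : ℂ)) =
        (Matrix.diagonal (fun i => (hρ.eigenvalues i : ℂ))).submatrix e e := by
      rw [Matrix.submatrix_diagonal_equiv]; rfl
    rw [this, Matrix.submatrix_mul_equiv, Matrix.submatrix_mul_equiv, hμ]
  rw [skewInfo_eq f (hρ.submatrix e) (hH.submatrix e) hV hμ']
  congr 1
  rw [← e.sum_comp]
  refine Finset.sum_congr rfl fun i _ => ?_
  rw [← e.sum_comp]
  refine Finset.sum_congr rfl fun j _ => ?_
  have hsub : (H * ρ).submatrix e e - (ρ * H).submatrix e e = (H * ρ - ρ * H).submatrix e e := rfl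
  rw [Matrix.conjTranspose_submatrix, Matrix.submatrix_mul_equiv, Matrix.submatrix_mul_equiv,
    hsub, Matrix.submatrix_mul_equiv, Matrix.submatrix_mul_equiv]
  rfl

end Spectral

/-! ### Bounds for the Morozova–Chentsov function. -/

section Bounds

variable {f : ℝ → ℝ}

/-- Operator monotonicity for `1 × 1` matrices. -/
lemma IsStandardOperatorMonotone.le (hf : IsStandardOperatorMonotone f) {x y : ℝ} (hx : 0 ≤ x)
    (hxy : x ≤ y) : f x ≤ f y := by
  have key : ∀ z : ℝ, 0 ≤ z → (algebraMap ℝ (Matrix (Fin 1) (Fin 1) ℂ) z).PosSemidef := by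
    intro z hz
    rw [Matrix.algebraMap_eq_diagonal]
    refine Matrix.PosSemidef.diagonal fun i => ?_
    simpa using hz
  have h := hf.monotone 1 (algebraMap ℝ _ x) (algebraMap ℝ _ y) (key x hx)
    (by rw [← map_sub]; exact key _ (sub_nonneg.mpr hxy))
  rw [cfc_algebraMap, cfc_algebraMap, ← map_sub] at h
  have h0 := h.diag_nonneg (i := 0)
  rw [Matrix.algebraMap_eq_diagonal] at h0
  simpa using h0

/-- Monotonicity gives `f (x / y) ≥ f 0`; applied after the symmetry `y f(x / y) = x f(y / x)`, it
gives the bound with `x`. -/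
lemma IsStandardOperatorMonotone.max_le (hf : IsStandardOperatorMonotone f) (hreg : IsRegular f)
    {x y : ℝ} (hx : 0 ≤ x) (hy : 0 < y) : f 0 * max x y ≤ y * f (x / y) := by
  have h0 : 0 < f 0 := hreg
  rw [mul_max_of_nonneg _ _ h0.le, max_le_iff]
  constructor
  · rcases hx.eq_or_lt with rfl | hx
    · simpa using mul_nonneg hy.le h0.le
    · have h1 := hf.symmetric (x / y) (div_pos hx hy)
      have h2 := hf.le le_rfl (one_div_nonneg.mpr (div_nonneg hx.le hy.le))
      rw [h1, ← mul_assoc, mul_div_cancel₀ _ hy.ne', mul_comm]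
      gcongr
  · rw [mul_comm]
    gcongr
    exact hf.le le_rfl (div_nonneg hx hy.le)

lemma mul_morozovaChentsov_le (hf : IsStandardOperatorMonotone f) (hreg : IsRegular f)
    {x y : ℝ} (hx : 0 ≤ x) (hy : 0 ≤ y) : f 0 * morozovaChentsov f x y ≤ (max x y)⁻¹ := by
  have h0 : 0 < f 0 := hreg
  unfold morozovaChentsov
  split_ifs with h
  · subst h
    rw [max_eq_left hx, mul_inv, mul_comm x⁻¹, ← mul_assoc, mul_inv_cancel₀ h0.ne', one_mul]
  · have hy' : 0 < y := lt_of_le_of_ne hy (Ne.symm h)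
    have hm : 0 < max x y := lt_max_of_lt_right hy'
    have := inv_anti₀ (mul_pos h0 hm) (hf.max_le hreg hx hy')
    calc f 0 * (y * f (x / y))⁻¹ ≤ f 0 * (f 0 * max x y)⁻¹ := by gcongr
      _ = _ := by rw [mul_inv, ← mul_assoc, mul_inv_cancel₀ h0.ne', one_mul]

/-- The condition `x ≠ y` excludes `(0, 0)`, where the convention `0⁻¹ = 0` makes the value vanish.
-/
lemma morozovaChentsov_pos (hf : IsStandardOperatorMonotone f) (hreg : IsRegular f)
    {x y : ℝ} (hx : 0 ≤ x) (hy : 0 ≤ y) (hxy : x ≠ y) : 0 < morozovaChentsov f x y := by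
  have h0 : 0 < f 0 := hreg
  unfold morozovaChentsov
  split_ifs with h
  · subst h
    exact inv_pos.mpr (mul_pos (lt_of_le_of_ne hx (Ne.symm hxy)) h0)
  · have hy' : 0 < y := lt_of_le_of_ne hy (Ne.symm h)
    exact inv_pos.mpr ((mul_pos h0 (lt_max_of_lt_right hy')).trans_le (hf.max_le hreg hx hy'))

lemma morozovaChentsov_nonneg (hf : IsStandardOperatorMonotone f) (hreg : IsRegular f)
    {x y : ℝ} (hx : 0 ≤ x) (hy : 0 ≤ y) : 0 ≤ morozovaChentsov f x y := by
  have h0 : 0 < f 0 := hreg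
  unfold morozovaChentsov
  split_ifs with h
  · positivity
  · have hy' : 0 < y := lt_of_le_of_ne hy (Ne.symm h)
    exact inv_nonneg.mpr ((mul_nonneg h0.le (le_max_of_le_right hy)).trans (hf.max_le hreg hx hy'))

end Bounds

end SkewInfo

namespace SkewInfo

/-! ### Upper bound for mixtures, and positivity. -/

section Estimates

variable {n K : Type*} [Fintype n] [DecidableEq n] [Fintype K] {f : ℝ → ℝ}

/-- Bessel's inequality for the rows of a matrix with mutually orthogonal rows. -/
lemma sum_inv_mul_norm_sq_le {W : Matrix n K ℂ} {μ : n → ℝ} (hμ : ∀ i, 0 ≤ μ i)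
    (hW : W * Wᴴ = Matrix.diagonal (fun i => (μ i : ℂ))) (g : K → ℂ) :
    ∑ j, (μ j)⁻¹ * ‖∑ k, g k * star (W j k)‖ ^ 2 ≤ ∑ k, ‖g k‖ ^ 2 := by
  classical
  -- The nonzero rows, normalized. Rows with `μ j = 0` drop out of the sum since `0⁻¹ = 0`.
  let v : {j // μ j ≠ 0} → EuclideanSpace ℂ K := fun j =>
    (((√(μ j))⁻¹ : ℝ) : ℂ) • WithLp.toLp 2 (W j)
  have hin : ∀ i j, inner ℂ (WithLp.toLp 2 (W i)) (WithLp.toLp 2 (W j)) =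
      if i = j then (μ i : ℂ) else 0 := by
    intro i j
    have h := congrFun (congrFun hW j) i
    rw [Matrix.mul_apply, Matrix.diagonal_apply] at h
    simp only [Matrix.conjTranspose_apply] at h
    rw [PiLp.inner_apply]
    simp only [RCLike.inner_apply]
    simp only [starRingEnd_apply]
    refine h.trans ?_
    by_cases hij : i = j
    · subst hij; simp
    · simp [hij, Ne.symm hij]
  have hv : Orthonormal ℂ v := by
    rw [orthonormal_iff_ite]
    intro i j
    have hi : 0 < μ i := lt_of_le_of_ne (hμ i) (Ne.symm i.2)
    simp only [v, inner_smul_left, inner_smul_right, hin, Complex.conj_ofReal]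
    by_cases hij : i = j
    · subst hij
      simp only [if_true]
      rw [← Complex.ofReal_mul, ← Complex.ofReal_mul, ← mul_assoc, ← mul_inv,
        Real.mul_self_sqrt hi.le, inv_mul_cancel₀ i.2, Complex.ofReal_one]
    · simp [hij, Subtype.coe_inj]
  have h := hv.sum_inner_products_le (x := WithLp.toLp 2 g) (s := Finset.univ)
  rw [EuclideanSpace.norm_sq_eq] at h
  refine le_trans (le_of_eq ?_) h
  have h2 : ∀ j : {j // μ j ≠ 0}, ‖inner ℂ (v j) (WithLp.toLp 2 g)‖ ^ 2 =
      (μ j)⁻¹ * ‖∑ k, g k * star (W j k)‖ ^ 2 := by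
    intro j
    simp only [v, inner_smul_left, norm_mul, mul_pow, PiLp.inner_apply, RCLike.inner_apply,
      Complex.conj_ofReal, Complex.norm_real, Real.norm_eq_abs, sq_abs, inv_pow, Real.sq_sqrt (hμ j)]
    rfl
  simp only [h2]
  refine Eq.trans ?_ (Finset.sum_subtype (Finset.univ.filter fun j => μ j ≠ 0) (by simp)
    (fun j => (μ j)⁻¹ * ‖∑ k, g k * star (W j k)‖ ^ 2))
  refine (Finset.sum_filter_of_ne fun j _ hj h0 => ?_).symm
  simp [h0] at hj

lemma sum_norm_sq_unitary_mul {U : Matrix n n ℂ} (hU : U * Uᴴ = 1) (C : Matrix n K ℂ) :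
    ∑ i, ∑ k, ‖(Uᴴ * C) i k‖ ^ 2 = ∑ i, ∑ k, ‖C i k‖ ^ 2 := by
  have key : ∀ D : Matrix n K ℂ, ((∑ i, ∑ k, ‖D i k‖ ^ 2 : ℝ) : ℂ) = (D * Dᴴ).trace := by
    intro D
    rw [Matrix.trace]
    push_cast
    refine Finset.sum_congr rfl fun i _ => ?_
    rw [Matrix.diag_apply, Matrix.mul_apply]
    refine Finset.sum_congr rfl fun k _ => ?_
    rw [Matrix.conjTranspose_apply]
    exact (Complex.mul_conj' _).symm
  apply Complex.ofReal_injective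
  rw [key, key, Matrix.conjTranspose_mul, Matrix.conjTranspose_conjTranspose, Matrix.mul_assoc,
    Matrix.trace_mul_comm, Matrix.mul_assoc, Matrix.mul_assoc, hU, Matrix.mul_one]

/-- The skew information of a mixture is bounded by the mean square deviation of the Hamiltonian
in the (unnormalized) components of the mixture. -/
lemma skewInfo_le (hf : IsStandardOperatorMonotone f) (hreg : IsRegular f) [DecidableEq K]
    (B : Matrix n K ℂ) {H : Matrix n n ℂ} (hH : H.IsHermitian) (d : K → ℝ) :
    skewInfo f (B * Bᴴ) H ≤
      2 * ∑ x, ∑ k, ‖(H * B - B * Matrix.diagonal (fun k => (d k : ℂ))) x k‖ ^ 2 := by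
  have hpos : (B * Bᴴ).PosSemidef := Matrix.posSemidef_self_mul_conjTranspose B
  have hρ := hpos.isHermitian
  have hU : (hρ.eigenvectorUnitary : Matrix n n ℂ)ᴴ * (hρ.eigenvectorUnitary : Matrix n n ℂ) = 1 :=
    Unitary.coe_star_mul_self _
  have hμ := mul_eigenvectorUnitary hρ
  rw [skewInfo_eq f hρ hH hU hμ]
  have hnn : ∀ i, 0 ≤ hρ.eigenvalues i := hpos.eigenvalues_nonneg
  set U : Matrix n n ℂ := (hρ.eigenvectorUnitary : Matrix n n ℂ)
  set μ := hρ.eigenvalues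
  have hU' : U * Uᴴ = 1 := mul_eq_one_comm.mp hU
  set D : Matrix K K ℂ := Matrix.diagonal (fun k => (d k : ℂ)) with hD
  have hDD : Dᴴ = D := by
    rw [hD, Matrix.diagonal_conjTranspose]; congr 1; ext k; simp
  set C := H * B - B * D with hC
  set W := Uᴴ * B with hWdef
  set G := Uᴴ * C with hGdef
  have hW : W * Wᴴ = Matrix.diagonal (fun i => (μ i : ℂ)) := by
    rw [hWdef, Matrix.conjTranspose_mul, Matrix.conjTranspose_conjTranspose]
    calc Uᴴ * B * (Bᴴ * U) = Uᴴ * ((B * Bᴴ) * U) := by simp only [Matrix.mul_assoc]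
      _ = _ := by rw [hμ, ← Matrix.mul_assoc, hU, Matrix.one_mul]
  -- `D` is self-adjoint, so the two `B D Bᴴ` terms cancel: each component may have its own
  -- reference energy.
  have hT : H * (B * Bᴴ) - B * Bᴴ * H = C * Bᴴ - B * Cᴴ := by
    rw [hC, Matrix.conjTranspose_sub, Matrix.conjTranspose_mul, Matrix.conjTranspose_mul, hDD,
      hH.eq, Matrix.sub_mul, Matrix.mul_sub]
    simp only [Matrix.mul_assoc]
    abel
  have hK : Uᴴ * (H * (B * Bᴴ) - B * Bᴴ * H) * U = G * Wᴴ - W * Gᴴ := by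
    rw [hT, Matrix.mul_sub, Matrix.sub_mul, hWdef, hGdef, Matrix.conjTranspose_mul,
      Matrix.conjTranspose_mul, Matrix.conjTranspose_conjTranspose]
    simp only [Matrix.mul_assoc]
  rw [hK, Finset.mul_sum]
  have hGW : ∀ i j, (G * Wᴴ) i j = ∑ k, G i k * star (W j k) := fun i j => rfl
  have hsum : ∑ i, ∑ j, (μ j)⁻¹ * ‖(G * Wᴴ) i j‖ ^ 2 ≤ ∑ i, ∑ k, ‖C i k‖ ^ 2 := by
    rw [← sum_norm_sq_unitary_mul hU' C]
    exact Finset.sum_le_sum fun i _ => sum_inv_mul_norm_sq_le hnn hW (G i)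
  have hWG : ∀ i j, ‖(W * Gᴴ) i j‖ = ‖(G * Wᴴ) j i‖ := by
    intro i j
    have : W * Gᴴ = (G * Wᴴ)ᴴ := by
      rw [Matrix.conjTranspose_mul G, Matrix.conjTranspose_conjTranspose]
    rw [this, Matrix.conjTranspose_apply, norm_star]
  -- Needed because `(max (μ i) (μ j))⁻¹ ≤ (μ j)⁻¹` can fail at `μ j = 0`, where the right side is
  -- `0`.
  have hzero : ∀ i j, μ j = 0 → (G * Wᴴ) i j = 0 := by
    intro i j hj
    have h := congrFun (congrFun hW j) j
    rw [Matrix.diagonal_apply_eq, hj, Matrix.mul_apply] at h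
    have h2 : ∑ k, ‖W j k‖ ^ 2 = 0 := by
      apply Complex.ofReal_injective
      push_cast
      rw [Complex.ofReal_zero] at h
      rw [← h]
      exact Finset.sum_congr rfl fun k _ => (Complex.mul_conj' _).symm
    rw [Finset.sum_eq_zero_iff_of_nonneg fun _ _ => sq_nonneg _] at h2
    rw [hGW]
    refine Finset.sum_eq_zero fun k _ => ?_
    have : W j k = 0 := by simpa using h2 k (Finset.mem_univ k)
    rw [this, star_zero, mul_zero]
  have hmax : ∀ i j, (max (μ i) (μ j))⁻¹ * ‖(G * Wᴴ) i j‖ ^ 2 ≤ (μ j)⁻¹ * ‖(G * Wᴴ) i j‖ ^ 2 := by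
    intro i j
    rcases (hnn j).eq_or_lt with hj | hj
    · rw [hzero i j hj.symm]; simp
    · gcongr
      exact le_max_right _ _
  -- The 2 from `‖u - v‖² ≤ 2‖u‖² + 2‖v‖²` cancels the one in `f 0 / 2`, and `f 0` is absorbed by
  -- `mul_morozovaChentsov_le`.
  have hterm : ∀ i j, f 0 / 2 * (morozovaChentsov f (μ i) (μ j) *
      ‖(G * Wᴴ - W * Gᴴ) i j‖ ^ 2) ≤
      (μ j)⁻¹ * ‖(G * Wᴴ) i j‖ ^ 2 + (μ i)⁻¹ * ‖(G * Wᴴ) j i‖ ^ 2 := by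
    intro i j
    have h1 : ‖(G * Wᴴ - W * Gᴴ) i j‖ ^ 2 ≤
        2 * ‖(G * Wᴴ) i j‖ ^ 2 + 2 * ‖(G * Wᴴ) j i‖ ^ 2 := by
      rw [Matrix.sub_apply, ← hWG i j]
      have := norm_sub_le ((G * Wᴴ) i j) ((W * Gᴴ) i j)
      nlinarith [norm_nonneg ((G * Wᴴ) i j - (W * Gᴴ) i j),
        sq_nonneg (‖(G * Wᴴ) i j‖ - ‖(W * Gᴴ) i j‖)]
    have h2 := mul_morozovaChentsov_le hf hreg (hnn i) (hnn j)
    have h3 := hmax i j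
    have h4 := hmax j i
    rw [max_comm] at h4
    have h5 : 0 ≤ (max (μ i) (μ j))⁻¹ := inv_nonneg.mpr (le_max_of_le_left (hnn i))
    have h6 := mul_le_mul h2 h1 (sq_nonneg _) h5
    linarith
  calc ∑ i, f 0 / 2 * ∑ j, morozovaChentsov f (μ i) (μ j) * ‖(G * Wᴴ - W * Gᴴ) i j‖ ^ 2
      ≤ ∑ i, ∑ j, ((μ j)⁻¹ * ‖(G * Wᴴ) i j‖ ^ 2 + (μ i)⁻¹ * ‖(G * Wᴴ) j i‖ ^ 2) := by
        refine Finset.sum_le_sum fun i _ => ?_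
        rw [Finset.mul_sum]
        exact Finset.sum_le_sum fun j _ => hterm i j
    _ = ∑ i, ∑ j, (μ j)⁻¹ * ‖(G * Wᴴ) i j‖ ^ 2 + ∑ i, ∑ j, (μ j)⁻¹ * ‖(G * Wᴴ) i j‖ ^ 2 := by
        simp only [Finset.sum_add_distrib]
        congr 1
        exact Finset.sum_comm
    _ ≤ 2 * ∑ i, ∑ k, ‖C i k‖ ^ 2 := by linarith

lemma skewInfo_nonneg (hf : IsStandardOperatorMonotone f) (hreg : IsRegular f)
    {ρ H : Matrix n n ℂ} (hpos : ρ.PosSemidef) (hH : H.IsHermitian) : 0 ≤ skewInfo f ρ H := by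
  have hρ := hpos.isHermitian
  rw [skewInfo_eq f hρ hH (Unitary.coe_star_mul_self _) (mul_eigenvectorUnitary hρ)]
  have h0 : 0 < f 0 := hreg
  refine mul_nonneg (by positivity) (Finset.sum_nonneg fun i _ => Finset.sum_nonneg fun j _ => ?_)
  exact mul_nonneg (morozovaChentsov_nonneg hf hreg (hpos.eigenvalues_nonneg i)
    (hpos.eigenvalues_nonneg j)) (sq_nonneg _)

/-- The skew information is positive for noncommuting states and Hamiltonians. -/
lemma skewInfo_pos (hf : IsStandardOperatorMonotone f) (hreg : IsRegular f)
    {ρ H : Matrix n n ℂ} (hpos : ρ.PosSemidef) (hH : H.IsHermitian) (hne : H * ρ ≠ ρ * H) :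
    0 < skewInfo f ρ H := by
  refine lt_of_le_of_ne (skewInfo_nonneg hf hreg hpos hH) fun h => hne ?_
  have hρ := hpos.isHermitian
  have hU : (hρ.eigenvectorUnitary : Matrix n n ℂ)ᴴ * (hρ.eigenvectorUnitary : Matrix n n ℂ) = 1 :=
    Unitary.coe_star_mul_self _
  have hμ := mul_eigenvectorUnitary hρ
  rw [skewInfo_eq f hρ hH hU hμ] at h
  have h0 : 0 < f 0 := hreg
  have hnn : ∀ i, 0 ≤ hρ.eigenvalues i := hpos.eigenvalues_nonneg
  set U : Matrix n n ℂ := (hρ.eigenvectorUnitary : Matrix n n ℂ)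
  set μ := hρ.eigenvalues
  have hU' : U * Uᴴ = 1 := mul_eq_one_comm.mp hU
  have hterm : ∀ i j, 0 ≤ morozovaChentsov f (μ i) (μ j) *
      ‖(Uᴴ * (H * ρ - ρ * H) * U) i j‖ ^ 2 := fun i j =>
    mul_nonneg (morozovaChentsov_nonneg hf hreg (hnn i) (hnn j)) (sq_nonneg _)
  have hs := (mul_eq_zero.mp h.symm).resolve_left (by positivity)
  have hs' : ∀ i j, morozovaChentsov f (μ i) (μ j) *
      ‖(Uᴴ * (H * ρ - ρ * H) * U) i j‖ ^ 2 = 0 := by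
    intro i j
    have h1 := (Finset.sum_eq_zero_iff_of_nonneg
      fun i _ => Finset.sum_nonneg fun j _ => hterm i j).mp hs i (Finset.mem_univ i)
    exact (Finset.sum_eq_zero_iff_of_nonneg fun j _ => hterm i j).mp h1 j (Finset.mem_univ j)
  have hUρ : Uᴴ * ρ = Matrix.diagonal (fun i => (μ i : ℂ)) * Uᴴ := by
    calc Uᴴ * ρ = Uᴴ * (ρ * U) * Uᴴ := by
          rw [Matrix.mul_assoc, Matrix.mul_assoc, hU', Matrix.mul_one]
      _ = _ := by rw [hμ, ← Matrix.mul_assoc, hU, Matrix.one_mul]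
  -- Between equal eigenvalues the commutator vanishes anyway; elsewhere the weight is strictly
  -- positive.
  have hK : Uᴴ * (H * ρ - ρ * H) * U = 0 := by
    ext i j
    by_cases hij : μ i = μ j
    · have : Uᴴ * (H * ρ - ρ * H) * U =
          (Uᴴ * H * U) * Matrix.diagonal (fun i => (μ i : ℂ)) -
            Matrix.diagonal (fun i => (μ i : ℂ)) * (Uᴴ * H * U) := by
        rw [Matrix.mul_sub, Matrix.sub_mul]
        congr 1
        · simp only [Matrix.mul_assoc]; rw [hμ]
        · simp only [← Matrix.mul_assoc]; rw [hUρ]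
      rw [this, Matrix.sub_apply, Matrix.mul_diagonal, Matrix.diagonal_mul, hij, mul_comm, sub_self,
        Matrix.zero_apply]
    · have := (mul_eq_zero.mp (hs' i j)).resolve_left
        (morozovaChentsov_pos hf hreg (hnn i) (hnn j) hij).ne'
      simpa using this
  rw [← sub_eq_zero]
  calc H * ρ - ρ * H = U * Uᴴ * (H * ρ - ρ * H) * (U * Uᴴ) := by rw [hU']; simp
    _ = U * (Uᴴ * (H * ρ - ρ * H) * U) * Uᴴ := by simp only [Matrix.mul_assoc]
    _ = 0 := by rw [hK]; simp

end Estimates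

end SkewInfo

/-! ### Overlaps of translated ancilla states. -/

noncomputable section

namespace SkewInfo

/-- The overlap `⟨η_t | η_s⟩` of two translates of an ancilla vector. -/
def shiftOverlap (η : ℤ → ℂ) (s t : ℤ) : ℂ := ∑' a : ℤ, η (a + s) * conj (η (a + t))

/-- This makes partial traces computable: the energy of the discarded parties is a common shift. -/
lemma shiftOverlap_add_right (η : ℤ → ℂ) (s t u : ℤ) :
    shiftOverlap η (s + u) (t + u) = shiftOverlap η s t := by
  unfold shiftOverlap
  rw [← (Equiv.addRight u).tsum_eq fun a => η (a + s) * conj (η (a + t))]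
  refine tsum_congr fun a => ?_
  simp only [Equiv.coe_addRight]
  rw [add_right_comm a u s, add_right_comm a u t, add_assoc a s, add_assoc a t]

lemma shiftOverlap_eq_sum (M : ℕ) (l s t : ℤ) {S : Finset ℤ}
    (hS : Finset.Ico (l - s) (l - s + M) ⊆ S) :
    shiftOverlap (ancillaState M l) s t =
      ∑ a ∈ S, ancillaState M l (a + s) * conj (ancillaState M l (a + t)) := by
  refine tsum_eq_sum fun a ha => ?_
  have : ancillaState M l (a + s) = 0 := by
    refine if_neg fun h => ha (hS ?_)
    rw [Finset.mem_Ico]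
    omega
  rw [this, zero_mul]

lemma ancillaState_mul_conj (M : ℕ) (l a b : ℤ) :
    ancillaState M l a * conj (ancillaState M l b) =
      ((if (l ≤ a ∧ a < l + M) ∧ l ≤ b ∧ b < l + M then (M : ℝ)⁻¹ else 0 : ℝ) : ℂ) := by
  unfold ancillaState
  split_ifs with h1 h2 h3 h4 <;> try simp_all
  rw [← Complex.ofReal_inv, ← Complex.ofReal_mul, ← mul_inv,
    Real.mul_self_sqrt (Nat.cast_nonneg M)]
  simp

lemma shiftOverlap_self {M : ℕ} (hM : M ≠ 0) (l s : ℤ) :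
    shiftOverlap (ancillaState M l) s s = 1 := by
  rw [shiftOverlap_eq_sum M l s s subset_rfl, Finset.sum_congr rfl (g := fun _ => (M : ℂ)⁻¹)]
  · simp [hM]
  · intro a ha
    rw [Finset.mem_Ico] at ha
    rw [ancillaState_mul_conj, if_pos (by omega)]
    simp

/-- All terms are nonnegative, and the one at `a = l` is positive because `l + 1 < l + M`. This
overlap is the coherence left in each qubit. -/
lemma shiftOverlap_zero_one_ne_zero {M : ℕ} (hM : 2 ≤ M) (l : ℤ) :
    shiftOverlap (ancillaState M l) 0 1 ≠ 0 := by
  rw [shiftOverlap_eq_sum M l 0 1 subset_rfl]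
  simp only [ancillaState_mul_conj]
  rw [← Complex.ofReal_sum, Complex.ofReal_ne_zero]
  refine (Finset.sum_pos' (fun a _ => ?_) ⟨l, ?_, ?_⟩).ne'
  · split_ifs <;> positivity
  · rw [Finset.mem_Ico]; omega
  · rw [if_pos (by omega)]
    positivity

/-! ### States left by the ancilla, and bipartite violation. -/

section MixedState

variable {n : Type*}

/-- The Hamiltonian with integer energy levels `w`. -/
def levelHamiltonian [DecidableEq n] (w : n → ℤ) : Matrix n n ℂ := Matrix.diagonal fun x => (w x : ℂ)

lemma levelHamiltonian_isHermitian [DecidableEq n] (w : n → ℤ) : (levelHamiltonian w).IsHermitian :=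
  Matrix.isHermitian_diagonal_of_self_adjoint _ (by ext x; simp)

/-- The state left when the ancilla is traced out of the uniform superposition of the vectors
`|x⟩ ⊗ Δ^{-w x}|η⟩`. -/
def tracedState [Fintype n] (η : ℤ → ℂ) (w : n → ℤ) : Matrix n n ℂ :=
  Matrix.of fun x y => (Fintype.card n : ℂ)⁻¹ * shiftOverlap η (w x) (w y)

/-- The column of `B` at `a` is the unnormalized vector of the system given ancilla level `a`.
Finitely many levels occur, and each confines the energy `w x` to a window of width `M`. -/
lemma exists_tracedState_eq_mul_conjTranspose [Fintype n] (M : ℕ) (l : ℤ) (w : n → ℤ) :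
    ∃ (S : Finset ℤ) (B : Matrix n S ℂ), tracedState (ancillaState M l) w = B * Bᴴ ∧
      ∀ x (a : S), B x a ≠ 0 → l ≤ a + w x ∧ a + w x < l + M := by
  refine ⟨Finset.univ.biUnion fun x => Finset.Ico (l - w x) (l - w x + M), Matrix.of fun x a =>
    (((√(Fintype.card n))⁻¹ : ℝ) : ℂ) * ancillaState M l (a + w x), ?_, ?_⟩
  · ext x y
    rw [tracedState, Matrix.of_apply, shiftOverlap_eq_sum M l (w x) (w y)
      (Finset.subset_biUnion_of_mem (fun x => Finset.Ico (l - w x) (l - w x + M))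
        (Finset.mem_univ x)), Matrix.mul_apply, ← Finset.sum_coe_sort, Finset.mul_sum]
    refine Finset.sum_congr rfl fun a _ => ?_
    have h : (Fintype.card n : ℂ)⁻¹ =
        (((√(Fintype.card n))⁻¹ : ℝ) : ℂ) * (((√(Fintype.card n))⁻¹ : ℝ) : ℂ) := by
      rw [← Complex.ofReal_mul, ← mul_inv, Real.mul_self_sqrt (Nat.cast_nonneg _)]
      simp
    rw [Matrix.conjTranspose_apply, Matrix.of_apply, Matrix.of_apply, star_mul',
      ← starRingEnd_apply, ← starRingEnd_apply, Complex.conj_ofReal, h]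
    ring
  · intro x a h
    by_contra hc
    exact h (by simp [ancillaState, hc])

lemma isState_tracedState [Fintype n] [Nonempty n] {M : ℕ} (hM : M ≠ 0) (l : ℤ) (w : n → ℤ) :
    IsState (tracedState (ancillaState M l) w) := by
  constructor
  · obtain ⟨S, B, h, -⟩ := exists_tracedState_eq_mul_conjTranspose M l w
    rw [h]
    exact Matrix.posSemidef_self_mul_conjTranspose B
  · simp [Matrix.trace, tracedState, shiftOverlap_self hM]

/-- The skew information of the traced-out state is bounded independently of the system. -/
lemma skewInfo_tracedState_le [Fintype n] [DecidableEq n] [Nonempty n] {f : ℝ → ℝ} (hf : IsStandardOperatorMonotone f)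
    (hreg : IsRegular f) {M : ℕ} (hM : M ≠ 0) (l : ℤ) (w : n → ℤ) :
    skewInfo f (tracedState (ancillaState M l) w) (levelHamiltonian w) ≤ 2 * (M : ℝ) ^ 2 := by
  have htr := (isState_tracedState hM l w).2
  obtain ⟨S, B, h, hB⟩ := exists_tracedState_eq_mul_conjTranspose M l w
  rw [h] at htr ⊢
  -- The reference energy `l - a` is the bottom of the window of column `a`, so deviations lie in
  -- `[0, M]`.
  refine (skewInfo_le hf hreg B (levelHamiltonian_isHermitian w)
    (fun a : S => ((l - a : ℤ) : ℝ))).trans ?_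
  have hB1 : ∑ x, ∑ a, ‖B x a‖ ^ 2 = 1 := by
    apply Complex.ofReal_injective
    rw [Complex.ofReal_one, ← htr, Matrix.trace]
    push_cast
    refine Finset.sum_congr rfl fun x _ => ?_
    rw [Matrix.diag_apply, Matrix.mul_apply]
    exact Finset.sum_congr rfl fun a _ => (Complex.mul_conj' _).symm
  have key : ∀ x a, ‖(levelHamiltonian w * B -
      B * Matrix.diagonal (fun a : S => (((l - a : ℤ) : ℝ) : ℂ))) x a‖ ^ 2 ≤
      (M : ℝ) ^ 2 * ‖B x a‖ ^ 2 := by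
    intro x a
    rw [levelHamiltonian, Matrix.sub_apply, Matrix.diagonal_mul, Matrix.mul_diagonal]
    have h1 : (w x : ℂ) * B x a - B x a * (((l - a : ℤ) : ℝ) : ℂ) =
        (((a + w x - l : ℤ) : ℝ) : ℂ) * B x a := by push_cast; ring
    rw [h1, norm_mul, mul_pow, Complex.norm_real, Real.norm_eq_abs, sq_abs]
    by_cases h0 : B x a = 0
    · simp [h0]
    · obtain ⟨h2, h3⟩ := hB x a h0
      have h4 : (0 : ℝ) ≤ ((a + w x - l : ℤ) : ℝ) := by exact_mod_cast (by omega)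
      have h5 : ((a + w x - l : ℤ) : ℝ) ≤ (M : ℝ) := by exact_mod_cast (by omega)
      gcongr
  calc _ ≤ 2 * ∑ x, ∑ a, (M : ℝ) ^ 2 * ‖B x a‖ ^ 2 := by
        gcongr with x _ a _
        exact key x a
    _ = 2 * (M : ℝ) ^ 2 := by simp only [← Finset.mul_sum]; rw [hB1, mul_one]

/-- The energy levels of a qubit. -/
def bitLevel (b : Fin 2) : ℤ := ((b : ℕ) : ℤ)

lemma qubitHamiltonian_eq : qubitHamiltonian = levelHamiltonian bitLevel := by
  ext i j
  fin_cases i <;> fin_cases j <;> simp [qubitHamiltonian, levelHamiltonian, bitLevel]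

lemma skewInfo_qubit_pos {f : ℝ → ℝ} (hf : IsStandardOperatorMonotone f)
    (hreg : IsRegular f) {M : ℕ} (hM : 2 ≤ M) (l : ℤ) :
    0 < skewInfo f (tracedState (ancillaState M l) bitLevel) qubitHamiltonian := by
  rw [qubitHamiltonian_eq]
  refine skewInfo_pos hf hreg (isState_tracedState (by omega) l _).1
    (levelHamiltonian_isHermitian _) fun h => ?_
  have h01 := congrFun (congrFun h 0) 1
  rw [levelHamiltonian, Matrix.diagonal_mul, Matrix.mul_diagonal] at h01
  simp [bitLevel, tracedState, shiftOverlap_zero_one_ne_zero hM l] at h01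

lemma tracedState_comp [Fintype n] (η : ℤ → ℂ) {m : Type*} [Fintype m] (e : m ≃ n) (w : n → ℤ) :
    tracedState η (w ∘ e) = (tracedState η w).submatrix e e := by
  ext x y
  simp [tracedState, Fintype.card_congr e]

lemma marginalFst_tracedState [Fintype n] (η : ℤ → ℂ) (w : n → ℤ) :
    marginalFst (tracedState η fun p : n × Fin 2 => w p.1 + bitLevel p.2) = tracedState η w := by
  ext x y
  simp only [marginalFst, tracedState, Matrix.of_apply, shiftOverlap_add_right]
  simp
  ring

lemma marginalSnd_tracedState [Fintype n] [Nonempty n] (η : ℤ → ℂ) (w : n → ℤ) :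
    marginalSnd (tracedState η fun p : n × Fin 2 => w p.1 + bitLevel p.2) =
      tracedState η bitLevel := by
  ext x y
  simp only [marginalSnd, tracedState, Matrix.of_apply, add_comm (w _), shiftOverlap_add_right]
  simp
  field_simp

lemma levelHamiltonian_kronecker [DecidableEq n] (w : n → ℤ) :
    levelHamiltonian w ⊗ₖ (1 : Matrix (Fin 2) (Fin 2) ℂ) +
      (1 : Matrix n n ℂ) ⊗ₖ levelHamiltonian bitLevel =
      levelHamiltonian fun p : n × Fin 2 => w p.1 + bitLevel p.2 := by
  rw [levelHamiltonian, levelHamiltonian, levelHamiltonian, ← Matrix.diagonal_one,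
    ← Matrix.diagonal_one, Matrix.diagonal_kronecker_diagonal, Matrix.diagonal_kronecker_diagonal,
    Matrix.diagonal_add]
  simp

end MixedState

/-- No regular metric-adjusted skew information is superadditive on bipartite systems. -/
theorem not_isBipartiteSuperadditive {f : ℝ → ℝ} (hf : IsStandardOperatorMonotone f)
    (hreg : IsRegular f) : ¬ IsBipartiteSuperadditive f := by
  intro hsup
  set η := ancillaState 2 0 with hη
  set c := skewInfo f (tracedState η bitLevel) qubitHamiltonian with hc
  have hcpos : 0 < c := skewInfo_qubit_pos hf hreg le_rfl 0
  -- Each induction step adjoins a qubit to the levels `w`: the marginals are the previous state and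
  -- the fixed qubit state, so the bound grows by `c`. The product is relabelled by `Fin (d * 2)` to
  -- iterate.
  have key : ∀ N : ℕ, ∃ (d : ℕ) (w : Fin d → ℤ), 0 < d ∧
      N * c ≤ skewInfo f (tracedState η w) (levelHamiltonian w) := by
    intro N
    induction N with
    | zero =>
      refine ⟨1, fun _ => 0, one_pos, ?_⟩
      rw [Nat.cast_zero, zero_mul]
      exact skewInfo_nonneg hf hreg (isState_tracedState two_ne_zero 0 _).1
        (levelHamiltonian_isHermitian _)
    | succ N ih =>
      obtain ⟨d, w, hd, h⟩ := ih
      have : Nonempty (Fin d) := ⟨⟨0, hd⟩⟩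
      set w' : Fin d × Fin 2 → ℤ := fun p => w p.1 + bitLevel p.2 with hw'
      have hstate : IsState (tracedState η w') := isState_tracedState two_ne_zero 0 w'
      have h1 := hsup d 2 (tracedState η w') (levelHamiltonian w) (levelHamiltonian bitLevel)
        hstate (levelHamiltonian_isHermitian _) (levelHamiltonian_isHermitian _)
      rw [marginalFst_tracedState, marginalSnd_tracedState, levelHamiltonian_kronecker,
        ← qubitHamiltonian_eq, ← hc, ← hw'] at h1
      refine ⟨d * 2, w' ∘ finProdFinEquiv.symm, by omega, ?_⟩
      have h2 : levelHamiltonian (w' ∘ finProdFinEquiv.symm) =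
          (levelHamiltonian w').submatrix finProdFinEquiv.symm finProdFinEquiv.symm := by
        rw [levelHamiltonian, levelHamiltonian, Matrix.submatrix_diagonal_equiv]
        rfl
      rw [tracedState_comp, h2, skewInfo_submatrix _ f hstate.1.isHermitian
        (levelHamiltonian_isHermitian _)]
      push_cast
      linarith
  -- Past this threshold `N c` exceeds the uniform bound `2 M²` at `M = 2`.
  obtain ⟨N, hN⟩ := exists_nat_gt (2 * ((2 : ℕ) : ℝ) ^ 2 / c)
  obtain ⟨d, w, hd, h⟩ := key N
  have : Nonempty (Fin d) := ⟨⟨0, hd⟩⟩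
  have h1 := skewInfo_tracedState_le hf hreg two_ne_zero 0 w
  rw [div_lt_iff₀ hcpos] at hN
  linarith

/-! ### Closed form of the protocol's output and its marginals. -/

section Protocol

/-- The total energy of a bit string. -/
def stringLevel {N : ℕ} (x : Fin N → Fin 2) : ℤ := ∑ k, bitLevel (x k)

lemma stringLevel_update {N : ℕ} (x : Fin N → Fin 2) (k : Fin N) (b : Fin 2) :
    stringLevel (Function.update x k b) = stringLevel x - bitLevel (x k) + bitLevel b := by
  have h : ∀ y : Fin N → Fin 2, stringLevel y =
      bitLevel (y k) + ∑ j ∈ Finset.univ.erase k, bitLevel (y j) := fun y =>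
    (Finset.add_sum_erase _ _ (Finset.mem_univ k)).symm
  rw [h (Function.update x k b), h x, Function.update_self, Finset.sum_congr rfl
    (g := fun j => bitLevel (x j))]
  · ring
  · intro j hj
    rw [Function.update_of_ne (Finset.ne_of_mem_erase hj)]

lemma hadamardGate_apply_zero (j : Fin 2) : hadamardGate j 0 = 1 / (√2 : ℂ) := by
  fin_cases j <;> simp [hadamardGate]

/-- By energy conservation the ancilla is shifted by minus the energy of the string. Each processed
qubit contributes `1 / √2`, as the first column of the gate is constant; untouched qubits remain
`0`. -/
lemma foldl_abergStep {N : ℕ} (η : ℤ → ℂ) (L : List (Fin N)) (hL : L.Nodup)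
    (x : Fin N → Fin 2) (a : ℤ) :
    L.foldl (fun Ψ m => abergStep hadamardGate m Ψ) (abergInitial N η) x a =
      if ∀ k, k ∉ L → x k = 0 then (1 / (√2 : ℂ)) ^ L.length * η (a + stringLevel x) else 0 := by
  induction L using List.reverseRecOn generalizing x a with
  | nil =>
    simp only [List.foldl_nil, abergInitial, funext_iff, Pi.zero_apply, List.not_mem_nil,
      not_false_eq_true, forall_const, List.length_nil, pow_zero, one_mul]
    split_ifs with h
    · simp [stringLevel, bitLevel, h]
    · rfl
  | append_singleton L m ih =>
    have hm : m ∉ L := by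
      have := List.nodup_append.mp hL
      intro h
      exact this.2.2 m h m (by simp) rfl
    have hL' : L.Nodup := (List.nodup_append.mp hL).1
    -- Qubit `m` is still `0` before its step, so the `k = 1` term vanishes.
    rw [List.foldl_append, List.foldl_cons, List.foldl_nil, abergStep, Fin.sum_univ_two, ih hL',
      ih hL', if_neg (c := ∀ k, k ∉ L → Function.update x m 1 k = 0), mul_zero, add_zero,
      hadamardGate_apply_zero, stringLevel_update]
    · have hiff : (∀ k, k ∉ L → Function.update x m 0 k = 0) ↔ ∀ k, k ∉ L ++ [m] → x k = 0 := by
        refine forall_congr' fun k => ?_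
        by_cases hk : k = m
        · subst hk; simp
        · simp [hk]
      simp only [hiff]
      split_ifs
      · rw [List.length_append, List.length_singleton, pow_succ', mul_assoc]
        congr 3
        simp only [bitLevel, Fin.val_zero]
        push_cast
        ring
      · simp
    · intro h
      simpa using h m hm

lemma abergState_eq (N : ℕ) (η : ℤ → ℂ) :
    abergState N hadamardGate η = tracedState η stringLevel := by
  have hfin : ∀ x a, abergFinal N hadamardGate η x a =
      (1 / (√2 : ℂ)) ^ N * η (a + stringLevel x) := by
    intro x a
    rw [abergFinal, foldl_abergStep η _ (List.nodup_finRange N)]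
    simp
  have h2 : (1 / (√2 : ℂ)) ^ N * conj ((1 / (√2 : ℂ)) ^ N) = ((2 : ℂ) ^ N)⁻¹ := by
    rw [map_pow, ← mul_pow, map_div₀, map_one, Complex.conj_ofReal, div_mul_div_comm, one_mul,
      ← Complex.ofReal_mul, Real.mul_self_sqrt zero_le_two]
    simp
  ext x y
  rw [abergState, tracedState, Matrix.of_apply, shiftOverlap, ← tsum_mul_left]
  refine tsum_congr fun a => ?_
  rw [hfin, hfin, map_mul, mul_mul_mul_comm, h2]
  simp

lemma totalHamiltonian_qubitHamiltonian (N : ℕ) :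
    totalHamiltonian (d := fun _ : Fin N => 2) (fun _ => qubitHamiltonian) =
      levelHamiltonian stringLevel := by
  ext x y
  rw [totalHamiltonian, Matrix.sum_apply, levelHamiltonian, Matrix.diagonal_apply]
  split_ifs with h
  · subst h
    simp [localOp, qubitHamiltonian_eq, levelHamiltonian, stringLevel]
  · refine Finset.sum_eq_zero fun k _ => ?_
    rw [localOp]
    split_ifs with hk
    · rw [qubitHamiltonian_eq, levelHamiltonian, Matrix.diagonal_apply_ne]
      intro hxy
      exact h (funext fun j => if hj : j = k then hj ▸ hxy else hk j hj)
    · rfl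

lemma card_filter_apply_eq {N : ℕ} (k : Fin N) (a : Fin 2) :
    2 * (Finset.univ.filter fun x : Fin N → Fin 2 => x k = a).card = 2 ^ N := by
  have h := Fintype.card_filter_piFinset_const_eq_of_mem (Finset.univ : Finset (Fin 2)) k
    (Finset.mem_univ a)
  rw [Fintype.piFinset_univ] at h
  rw [h, Finset.card_univ, Fintype.card_fin, Fintype.card_fin, ← pow_succ',
    Nat.sub_add_cancel (Fin.pos k)]

lemma marginal_tracedState (η : ℤ → ℂ) {N : ℕ} (k : Fin N) :
    marginal (d := fun _ : Fin N => 2) k (tracedState η stringLevel) =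
      tracedState η bitLevel := by
  ext a b
  rw [marginal, Finset.sum_congr rfl (g := fun _ => ((2 : ℂ) ^ N)⁻¹ *
    shiftOverlap η (bitLevel a) (bitLevel b))]
  · have h : (2 : ℂ) * ((Finset.univ.filter fun x : Fin N → Fin 2 => x k = a).card : ℂ) = 2 ^ N :=
      by exact_mod_cast card_filter_apply_eq k a
    rw [Finset.sum_const, nsmul_eq_mul, tracedState, Matrix.of_apply, Fintype.card_fin, ← mul_assoc,
      ← h]
    congr 1
    have h0 : ((Finset.univ.filter fun x : Fin N → Fin 2 => x k = a).card : ℂ) ≠ 0 := by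
      intro h0
      rw [h0, mul_zero] at h
      exact pow_ne_zero N two_ne_zero h.symm
    rw [mul_inv, mul_left_comm, mul_inv_cancel₀ h0, mul_one]
    rfl
  · intro x hx
    have hxk : x k = a := (Finset.mem_filter.mp hx).2
    have h1 := stringLevel_update x k b
    rw [hxk] at h1
    -- The energy of the other qubits is the common shift `stringLevel x - bitLevel a`.
    have h2 : stringLevel x = bitLevel a + (stringLevel x - bitLevel a) := by ring
    have h3 : stringLevel (Function.update x k b) = bitLevel b + (stringLevel x - bitLevel a) := by
      rw [h1]; ring
    rw [tracedState, Matrix.of_apply, h3]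
    nth_rewrite 1 [h2]
    rw [shiftOverlap_add_right]
    simp

end Protocol

/-- Åberg's protocol violates superadditivity for sufficiently many qubits. -/
theorem exists_skewInfo_abergState_lt {f : ℝ → ℝ} (hf : IsStandardOperatorMonotone f)
    (hreg : IsRegular f) {M : ℕ} (hM : 2 ≤ M) (l : ℤ) : ∃ N₀ : ℕ, ∀ N : ℕ, N₀ ≤ N →
      IsState (abergState N hadamardGate (ancillaState M l)) ∧
      skewInfo f (abergState N hadamardGate (ancillaState M l))
          (totalHamiltonian (d := fun _ : Fin N => 2) (fun _ => qubitHamiltonian)) <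
        ∑ k : Fin N, skewInfo f (marginal (d := fun _ : Fin N => 2) k
          (abergState N hadamardGate (ancillaState M l))) qubitHamiltonian := by
  have hc := skewInfo_qubit_pos hf hreg hM l
  obtain ⟨N₀, hN₀⟩ := exists_nat_gt (2 * (M : ℝ) ^ 2 /
    skewInfo f (tracedState (ancillaState M l) bitLevel) qubitHamiltonian)
  rw [div_lt_iff₀ hc] at hN₀
  refine ⟨N₀, fun N hN => ?_⟩
  simp only [abergState_eq, totalHamiltonian_qubitHamiltonian, marginal_tracedState]
  refine ⟨isState_tracedState (by omega) l _, ?_⟩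
  rw [Finset.sum_const, Finset.card_univ, Fintype.card_fin, nsmul_eq_mul]
  refine (skewInfo_tracedState_le hf hreg (by omega) l _).trans_lt (hN₀.trans_le ?_)
  gcongr

end SkewInfo

end

theorem theorem1 (f : ℝ → ℝ) (hf : SkewInfo.IsStandardOperatorMonotone f)
    (hreg : SkewInfo.IsRegular f) :
    ¬ SkewInfo.IsSuperadditive f ∧
    ¬ SkewInfo.IsBipartiteSuperadditive f ∧
    ∀ (M : ℕ) (l : ℤ), 2 ≤ M → ∃ N₀ : ℕ, ∀ N : ℕ, N₀ ≤ N →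
      let ρ := SkewInfo.abergState N SkewInfo.hadamardGate (SkewInfo.ancillaState M l)
      SkewInfo.IsState ρ ∧
      SkewInfo.skewInfo f ρ
          (SkewInfo.totalHamiltonian (d := fun _ : Fin N => 2)
            (fun _ => SkewInfo.qubitHamiltonian)) <
        ∑ k : Fin N, SkewInfo.skewInfo f
          (SkewInfo.marginal (d := fun _ : Fin N => 2) k ρ) SkewInfo.qubitHamiltonian := by
  refine ⟨fun hsup => ?_, SkewInfo.not_isBipartiteSuperadditive hf hreg,
    fun M l hM => SkewInfo.exists_skewInfo_abergState_lt hf hreg hM l⟩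
  -- The protocol with `M = 2`, `l = 0` already refutes superadditivity.
  obtain ⟨N, hN⟩ := SkewInfo.exists_skewInfo_abergState_lt hf hreg le_rfl 0
  obtain ⟨hstate, hlt⟩ := hN N le_rfl
  refine (hsup N (fun _ => 2) _ (fun _ => SkewInfo.qubitHamiltonian) hstate fun _ => ?_).not_gt hlt
  rw [SkewInfo.qubitHamiltonian_eq]
  exact SkewInfo.levelHamiltonian_isHermitian _
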